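/- Let $A$ be a bounded normal operator on a complex Hilbert space $H$, with spectrum $\sigma(A)$ and spectral measure $E_A$ (on the Borel sets of $\sigma(A)$), and for a bounded Borel function $g:\sigma(A)\to\mathbb C$ write $g(A)=\int g\,dE_A$. Let $U\subseteq\mathbb C$ be an open set containing $\sigma(A)$, let $p_1,\dots,p_K$ be holomorphic on $U$, let $f=p_K\circ\cdots\circ p_1$, and let $f^m$ be the $m$-fold composition of $f$ with itself ($f^0=\mathrm{id}$). Assume that all the composites $f^m$ are defined on $\sigma(A)$, i.e. that for every $\lambda\in\sigma(A)$, $m\ge 0$ and $0\le k<K$ the point $(p_k\circ\cdots\circ p_1)(f^m(\lambda))$ lies in $U$. Suppose that $$\sup_{m}\ \sup_{\lambda\in\sigma(A)}|f^m(\lambda)|<\infty$$ and that $f^m(\lambda)\to\chi(\lambda)$ as $m\to\infty$ for every $\lambda\in\sigma(A)$, where $\chi:\sigma(A)\to\mathbb C$ is a Borel function. Then $f^m(A)\to\chi(A)$ in the strong operator topology, that is, $f^m(A)x\to\chi(A)x$ for every $x\in H$. If, moreover, $\chi$ takes only the values $0$ and $1$, then $P:=\chi(A)$ is an orthogonal projection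 that commutes with $A$, $P=E_A(\chi^{-1}(\{1\}))$, in particular $\operatorname{Ran}P=E_A(\chi^{-1}(\{1\}))H$, and $\sigma(P)=\{0,1\}$ unless $P=0$ or $P=I$. -/

import Mathlib

open MeasureTheory Filter Topology
open scoped ENNReal InnerProductSpace CompactlySupported

set_option linter.unusedSectionVars false

noncomputable section


/-- A projection-valued measure on `X` with values in the orthogonal projections of `H`. As for
vector measures, the value on a set that is not measurable is `0` by convention. -/
structure ProjectionValuedMeasure (X : Type*) [MeasurableSpace X] (H : Type*)
    [NormedAddCommGroup H] [InnerProductSpace ℂ H] [CompleteSpace H] where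
  /-- The projection attached to a set. -/
  toFun : Set X → (H →L[ℂ] H)
  isStarProjection : ∀ S, MeasurableSet S → IsStarProjection (toFun S)
  univ : toFun Set.univ = 1
  inter : ∀ S T, MeasurableSet S → MeasurableSet T → toFun (S ∩ T) = toFun S * toFun T
  hasSum_iUnion : ∀ S : ℕ → Set X, (∀ i, MeasurableSet (S i)) → Pairwise (Function.onFun Disjoint S) →
    ∀ x : H, HasSum (fun i => toFun (S i) x) (toFun (⋃ i, S i) x)
  not_measurable : ∀ S, ¬ MeasurableSet S → toFun S = 0

namespace ProjectionValuedMeasure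

variable {X : Type*} [MeasurableSpace X] {H : Type*}
  [NormedAddCommGroup H] [InnerProductSpace ℂ H] [CompleteSpace H]

instance : CoeFun (ProjectionValuedMeasure X H) (fun _ => Set X → (H →L[ℂ] H)) := ⟨toFun⟩

theorem re_inner_nonneg (E : ProjectionValuedMeasure X H) (x : H) {S : Set X}
    (hS : MeasurableSet S) : 0 ≤ (⟪x, E S x⟫_ℂ).re := by
  have h := E.isStarProjection S hS
  have h1 : E S = star (E S) * E S := by
    rw [h.isSelfAdjoint.star_eq, h.isIdempotentElem.eq]
  rw [h1, ContinuousLinearMap.star_eq_adjoint, mul_apply_eq_comp,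
    ContinuousLinearMap.adjoint_inner_right]
  exact inner_self_nonneg (𝕜 := ℂ)

/-- The finite positive measure `S ↦ ⟪x, E(S) x⟫`. -/
def measure (E : ProjectionValuedMeasure X H) (x : H) : Measure X :=
  Measure.ofMeasurable (fun S _ => ENNReal.ofReal (⟪x, E S x⟫_ℂ).re)
    (by
      have h := (E.hasSum_iUnion (fun _ => ∅) (fun _ => .empty) (fun _ _ _ => by simp) x).summable
      rw [summable_const_iff] at h
      simp [h])
    (by
      intro S hS hd
      have h := (E.hasSum_iUnion S hS hd x).mapL (innerSL ℂ x)
      have h' := Complex.hasSum_re h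
      rw [← ENNReal.ofReal_tsum_of_nonneg (fun i => E.re_inner_nonneg x (hS i)) h'.summable]
      exact congrArg _ h'.tsum_eq.symm)

/-- The operator `T = ∫ g dE`: the (unique) bounded operator on `H` such that
`⟪x, T x⟫ = ∫ g(z) d⟪x, E(z) x⟫` for all `x`. By convention it is `0` if there is no such
operator; there is one whenever `g` is bounded and measurable. -/
def integral (E : ProjectionValuedMeasure X H) (g : X → ℂ) : H →L[ℂ] H :=
  open Classical in
  if h : ∃ T : H →L[ℂ] H, ∀ x, ⟪x, T x⟫_ℂ = ∫ z, g z ∂(E.measure x) then h.choose else 0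

theorem eq_of_inner_self {S T : H →L[ℂ] H} (h : ∀ x, ⟪x, S x⟫_ℂ = ⟪x, T x⟫_ℂ) : S = T := by
  have : (S : H →ₗ[ℂ] H) = T := by
    rw [← ext_inner_map]
    intro x
    rw [← inner_conj_symm, ← inner_conj_symm (T.toLinearMap x)]
    exact congrArg _ (h x)
  exact ContinuousLinearMap.coe_injective this

theorem integral_eq (E : ProjectionValuedMeasure X H) {g : X → ℂ} {T : H →L[ℂ] H}
    (hT : ∀ x, ⟪x, T x⟫_ℂ = ∫ z, g z ∂(E.measure x)) : E.integral g = T := by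
  have h : ∃ T : H →L[ℂ] H, ∀ x, ⟪x, T x⟫_ℂ = ∫ z, g z ∂(E.measure x) := ⟨T, hT⟩
  rw [integral, dif_pos h]
  exact eq_of_inner_self fun x => (h.choose_spec x).trans (hT x).symm

end ProjectionValuedMeasure

namespace BorelCalculus

section Construction

variable {X : Type*} [TopologicalSpace X] [CompactSpace X] [T2Space X]
  [TopologicalSpace.PseudoMetrizableSpace X] [MeasurableSpace X] [BorelSpace X]
  {H : Type*} [NormedAddCommGroup H] [InnerProductSpace ℂ H] [CompleteSpace H]
  (Φ : C(X, ℂ) →⋆ₐ[ℂ] (H →L[ℂ] H))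

/-- A real compactly supported function, seen as a complex continuous function. -/
def toComplex (f : C_c(X, ℝ)) : C(X, ℂ) := ⟨fun z => (f z : ℂ), by fun_prop⟩

theorem inner_star_mul (f g : C(X, ℂ)) (x : H) :
    ⟪x, Φ (star f * g) x⟫_ℂ = ⟪Φ f x, Φ g x⟫_ℂ := by
  rw [map_mul, map_star, ContinuousLinearMap.star_eq_adjoint, mul_apply_eq_comp,
    ContinuousLinearMap.adjoint_inner_right]

/-- The positive functional `f ↦ ⟪x, Φ(f) x⟫` on real continuous functions. -/
def scalarFunctional (x : H) : C_c(X, ℝ) →ₚ[ℝ] ℝ :=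
  PositiveLinearMap.mk₀
    { toFun := fun f => (⟪x, Φ (toComplex f) x⟫_ℂ).re
      map_add' := fun f g => by
        have : toComplex (f + g) = toComplex f + toComplex g := by
          ext z; simp [toComplex]
        rw [this, map_add, add_apply, inner_add_right, Complex.add_re]
      map_smul' := fun c f => by
        have : toComplex (c • f) = (c : ℂ) • toComplex f := by
          ext z; simp [toComplex]
        rw [this, map_smul, smul_apply, inner_smul_right, Complex.re_ofReal_mul]
        rfl }
    (fun f hf => by
      let s : C(X, ℂ) := ⟨fun z => ((Real.sqrt (f z) : ℝ) : ℂ), by fun_prop⟩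
      have : toComplex f = star s * s := by
        ext z
        have hz : 0 ≤ f z := hf z
        simp only [toComplex, s, ContinuousMap.coe_mk, ContinuousMap.mul_apply,
          ContinuousMap.star_apply, RCLike.star_def, Complex.conj_ofReal]
        rw [← Complex.ofReal_mul, Real.mul_self_sqrt hz]
      simp only [LinearMap.coe_mk, AddHom.coe_mk]
      rw [this, inner_star_mul]
      exact inner_self_nonneg (𝕜 := ℂ))

/-- The measure `μ_x` on `X` with `∫ f dμ_x = ⟪x, Φ(f) x⟫` for all continuous `f`. -/
def scalarMeasure (x : H) : Measure X := RealRMK.rieszMeasure (scalarFunctional Φ x)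

instance (x : H) : IsFiniteMeasure (scalarMeasure Φ x) := by
  unfold scalarMeasure; infer_instance

instance (x : H) : (scalarMeasure Φ x).Regular := by
  unfold scalarMeasure; infer_instance

theorem integral_real (x : H) (f : C(X, ℝ)) :
    ∫ z, f z ∂(scalarMeasure Φ x)
      = (⟪x, Φ ⟨fun z => (f z : ℂ), by fun_prop⟩ x⟫_ℂ).re :=
  RealRMK.integral_rieszMeasure (scalarFunctional Φ x)
    ⟨f, HasCompactSupport.of_compactSpace _⟩

theorem integral_cont (x : H) (f : C(X, ℂ)) :
    ∫ z, f z ∂(scalarMeasure Φ x) = ⟪x, Φ f x⟫_ℂ := by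
  have key : ∀ g : C(X, ℝ), ∫ z, (g z : ℂ) ∂(scalarMeasure Φ x)
      = ⟪x, Φ ⟨fun z => (g z : ℂ), by fun_prop⟩ x⟫_ℂ := by
    intro g
    rw [integral_complex_ofReal, integral_real]
    set G : C(X, ℂ) := ⟨fun z => (g z : ℂ), by fun_prop⟩ with hG
    have hs : star G = G := by ext z; simp [hG]
    have h1 : ⟪x, Φ G x⟫_ℂ = ⟪Φ G x, x⟫_ℂ := by
      have := inner_star_mul Φ G 1 x
      simpa [hs] using this
    have : (starRingEnd ℂ) ⟪x, Φ G x⟫_ℂ = ⟪x, Φ G x⟫_ℂ := by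
      rw [inner_conj_symm, h1]
    exact Complex.conj_eq_iff_re.mp this
  let r : C(X, ℝ) := ⟨fun z => (f z).re, by fun_prop⟩
  let i : C(X, ℝ) := ⟨fun z => (f z).im, by fun_prop⟩
  let R : C(X, ℂ) := ⟨fun z => (r z : ℂ), by fun_prop⟩
  let J : C(X, ℂ) := ⟨fun z => (i z : ℂ), by fun_prop⟩
  have hf : f = R + Complex.I • J := by
    ext z
    simp [R, J, r, i, mul_comm Complex.I, Complex.re_add_im]
  have hi : ∀ F : C(X, ℂ), Integrable F (scalarMeasure Φ x) := fun F =>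
    F.continuous.integrable_of_hasCompactSupport (HasCompactSupport.of_compactSpace _)
  have h2 : ∫ z, f z ∂(scalarMeasure Φ x)
      = ∫ z, R z ∂(scalarMeasure Φ x) + Complex.I * ∫ z, J z ∂(scalarMeasure Φ x) := by
    rw [← integral_const_mul, ← integral_add (hi R) ((hi J).const_mul _)]
    conv_lhs => rw [hf]
    simp
  rw [h2]
  have hR : ∫ z, R z ∂(scalarMeasure Φ x) = ⟪x, Φ R x⟫_ℂ := key r
  have hJ : ∫ z, J z ∂(scalarMeasure Φ x) = ⟪x, Φ J x⟫_ℂ := key i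
  rw [hR, hJ]
  conv_rhs => rw [hf]
  rw [map_add, map_smul, add_apply, smul_apply, inner_add_right, inner_smul_right]

theorem enorm_apply (x : H) (f : C(X, ℂ)) :
    ‖Φ f x‖ₑ = eLpNorm f 2 (scalarMeasure Φ x) := by
  have hi : Integrable (fun z => ‖f z‖ ^ 2) (scalarMeasure Φ x) :=
    (by fun_prop : Continuous fun z => ‖f z‖ ^ 2).integrable_of_hasCompactSupport
      (HasCompactSupport.of_compactSpace _)
  have h1 : ∫ z, ‖f z‖ ^ 2 ∂(scalarMeasure Φ x) = ‖Φ f x‖ ^ 2 := by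
    have h := integral_cont Φ x (star f * f)
    rw [inner_star_mul, inner_self_eq_norm_sq_to_K] at h
    have h3 : ∀ z, (star f * f) z = ((‖f z‖ ^ 2 : ℝ) : ℂ) := by
      intro z
      simp [Complex.conj_mul']
    simp_rw [h3] at h
    rw [integral_complex_ofReal] at h
    apply Complex.ofReal_injective
    rw [h]
    simp
  rw [eLpNorm_eq_lintegral_rpow_enorm_toReal (by norm_num) (by norm_num)]
  have h2 : ∫⁻ z, ‖f z‖ₑ ^ (2 : ℝ≥0∞).toReal ∂(scalarMeasure Φ x)
      = ENNReal.ofReal (‖Φ f x‖ ^ 2) := by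
    rw [← h1, ofReal_integral_eq_lintegral_ofReal hi (ae_of_all _ fun z => by positivity)]
    refine lintegral_congr fun z => ?_
    rw [ENNReal.ofReal_pow (norm_nonneg _), ofReal_norm]
    norm_num
  rw [h2, ENNReal.ofReal_pow (norm_nonneg _), ofReal_norm]
  rw [← ENNReal.rpow_natCast, ← ENNReal.rpow_mul]
  norm_num


/-- Bounded Borel functions. -/
def IsBddBorel (g : X → ℂ) : Prop := Measurable g ∧ ∃ M : ℝ, ∀ z, ‖g z‖ ≤ M

theorem IsBddBorel.memLp {g : X → ℂ} (hg : IsBddBorel g) (ν : Measure X) [IsFiniteMeasure ν] :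
    MemLp g 2 ν := by
  obtain ⟨hm, M, hM⟩ := hg
  exact MemLp.of_bound hm.aestronglyMeasurable M (ae_of_all _ hM)

theorem IsBddBorel.approx {g : X → ℂ} (hg : IsBddBorel g) (ν : Measure X) [IsFiniteMeasure ν]
    {ε : ℝ≥0∞} (hε : ε ≠ 0) : ∃ f : C(X, ℂ), eLpNorm (g - ⇑f) 2 ν ≤ ε := by
  obtain ⟨f, hf, -⟩ := (hg.memLp ν).exists_boundedContinuous_eLpNorm_sub_le (by norm_num) hε
  exact ⟨f.toContinuousMap, hf⟩

theorem isBddBorel_cont (f : C(X, ℂ)) : IsBddBorel f :=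
  ⟨f.continuous.measurable, ‖f‖, f.norm_coe_le_norm⟩

theorem IsBddBorel.sub {g h : X → ℂ} (hg : IsBddBorel g) (hh : IsBddBorel h) :
    IsBddBorel (g - h) := by
  obtain ⟨hm, M, hM⟩ := hg
  obtain ⟨hm', M', hM'⟩ := hh
  exact ⟨hm.sub hm', M + M', fun z => (norm_sub_le _ _).trans (add_le_add (hM z) (hM' z))⟩

theorem IsBddBorel.mul {g h : X → ℂ} (hg : IsBddBorel g) (hh : IsBddBorel h) :
    IsBddBorel (g * h) := by
  obtain ⟨hm, M, hM⟩ := hg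
  obtain ⟨hm', M', hM'⟩ := hh
  refine ⟨hm.mul hm', M * M', fun z => ?_⟩
  rw [Pi.mul_apply, norm_mul]
  exact mul_le_mul (hM z) (hM' z) (norm_nonneg _) ((norm_nonneg _).trans (hM z))

theorem IsBddBorel.sub_comm_le {g h k : X → ℂ} (hg : IsBddBorel g) (hh : IsBddBorel h)
    (hk : IsBddBorel k) (ν : Measure X) [IsFiniteMeasure ν] :
    eLpNorm (g - h) 2 ν ≤ eLpNorm (k - g) 2 ν + eLpNorm (k - h) 2 ν := by
  rw [eLpNorm_sub_comm k g]
  calc eLpNorm (g - h) 2 ν = eLpNorm ((g - k) + (k - h)) 2 ν := by rw [sub_add_sub_cancel]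
    _ ≤ _ := eLpNorm_add_le ((hg.sub hk).memLp ν).1 ((hk.sub hh).memLp ν).1 (by norm_num)

theorem enorm_sub_apply (x : H) (f k : C(X, ℂ)) :
    ‖Φ k x - Φ f x‖ₑ = eLpNorm (k - f : X → ℂ) 2 (scalarMeasure Φ x) := by
  have : Φ k x - Φ f x = Φ (k - f) x := by rw [map_sub, sub_apply]
  rw [this, enorm_apply]; rfl

/-- `v` is the value `g(Φ) x`: the limit of `Φ(f) x` as `f → g` in `L²(μ_x)`. -/
def IsRep (g : X → ℂ) (x v : H) : Prop :=
  ∀ f : C(X, ℂ), ‖v - Φ f x‖ₑ ≤ eLpNorm (g - ⇑f) 2 (scalarMeasure Φ x)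

theorem isRep_of {g : X → ℂ} (hg : IsBddBorel g) {x u : H} (C : ℝ≥0∞) (hC : C ≠ ⊤)
    (h : ∀ ε : ℝ≥0∞, ε ≠ 0 → ε ≠ ⊤ → ∃ k : C(X, ℂ), eLpNorm (g - ⇑k) 2 (scalarMeasure Φ x) ≤ C * ε ∧
      ‖u - Φ k x‖ₑ ≤ C * ε) : IsRep Φ g x u := by
  intro f
  refine ENNReal.le_of_forall_pos_le_add fun δ hδ _ => ?_
  obtain ⟨k, hk1, hk2⟩ := h (δ / (2 * C + 1))
    (ENNReal.div_ne_zero.2 ⟨by simpa using hδ.ne', by finiteness⟩)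
    (ENNReal.div_ne_top (by simp) (by simp))
  have h2 : 2 * (C * (δ / (2 * C + 1))) ≤ δ := by
    rw [← mul_assoc, ← mul_div_assoc]
    refine ENNReal.div_le_of_le_mul ?_
    rw [mul_comm]
    gcongr
    exact le_self_add
  have h1 := (isBddBorel_cont k).sub_comm_le (isBddBorel_cont f) hg (scalarMeasure Φ x)
  calc ‖u - Φ f x‖ₑ = ‖(u - Φ k x) + (Φ k x - Φ f x)‖ₑ := by rw [sub_add_sub_cancel]
    _ ≤ ‖u - Φ k x‖ₑ + ‖Φ k x - Φ f x‖ₑ := enorm_add_le _ _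
    _ ≤ C * (δ / (2 * C + 1)) + (C * (δ / (2 * C + 1)) + eLpNorm (g - ⇑f) 2 (scalarMeasure Φ x)) := by
        rw [enorm_sub_apply]
        exact add_le_add hk2 (h1.trans (by gcongr))
    _ = eLpNorm (g - ⇑f) 2 (scalarMeasure Φ x) + 2 * (C * (δ / (2 * C + 1))) := by ring
    _ ≤ _ := by gcongr

theorem IsRep.sub_le {g g' : X → ℂ} (hg : IsBddBorel g) (hg' : IsBddBorel g') {x v v' : H}
    (h : IsRep Φ g x v) (h' : IsRep Φ g' x v') :
    ‖v - v'‖ₑ ≤ eLpNorm (g - g') 2 (scalarMeasure Φ x) := by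
  refine ENNReal.le_of_forall_pos_le_add fun δ hδ _ => ?_
  obtain ⟨k, hk⟩ := hg.approx (scalarMeasure Φ x) (ε := (δ : ℝ≥0∞) / 2) (by simpa using hδ.ne')
  have h1 := hg'.sub_comm_le (isBddBorel_cont k) hg (scalarMeasure Φ x)
  calc ‖v - v'‖ₑ = ‖(v - Φ k x) - (v' - Φ k x)‖ₑ := by rw [sub_sub_sub_cancel_right]
    _ ≤ ‖v - Φ k x‖ₑ + ‖v' - Φ k x‖ₑ := enorm_sub_le
    _ ≤ δ / 2 + (eLpNorm (g - g') 2 (scalarMeasure Φ x) + δ / 2) :=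
        add_le_add ((h k).trans hk) ((h' k).trans (h1.trans (by gcongr)))
    _ = eLpNorm (g - g') 2 (scalarMeasure Φ x) + (δ / 2 + δ / 2) := by ring
    _ = _ := by rw [ENNReal.add_halves]

theorem IsRep.unique {g : X → ℂ} (hg : IsBddBorel g) {x v v' : H}
    (h : IsRep Φ g x v) (h' : IsRep Φ g x v') : v = v' := by
  have := h.sub_le Φ hg hg h'
  simpa [sub_eq_zero] using this

theorem exists_isRep {g : X → ℂ} (hg : IsBddBorel g) (x : H) : ∃ v, IsRep Φ g x v := by
  have : ∀ n : ℕ, ∃ f : C(X, ℂ), eLpNorm (g - ⇑f) 2 (scalarMeasure Φ x) ≤ 1 / 2 ^ n := fun n =>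
    hg.approx _ (by simp)
  choose f hf using this
  have hc : CauchySeq fun n => Φ (f n) x := by
    refine cauchySeq_of_edist_le_geometric_two 2 (by norm_num) fun n => ?_
    rw [edist_eq_enorm_sub, enorm_sub_apply]
    refine ((isBddBorel_cont _).sub_comm_le (isBddBorel_cont _) hg _).trans ?_
    refine (add_le_add (hf n) (hf (n + 1))).trans ?_
    have : (1 : ℝ≥0∞) / 2 ^ (n + 1) ≤ 1 / 2 ^ n := by
      gcongr <;> norm_num
    refine (add_le_add le_rfl this).trans ?_
    rw [ENNReal.div_add_div_same, one_add_one_eq_two]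
  obtain ⟨v, hv⟩ := cauchySeq_tendsto_of_complete hc
  refine ⟨v, fun k => ?_⟩
  have h1 : Tendsto (fun n => ‖Φ (f n) x - Φ k x‖ₑ) atTop (𝓝 ‖v - Φ k x‖ₑ) :=
    (hv.sub_const _).enorm
  have h2 : Tendsto (fun n : ℕ => (1 : ℝ≥0∞) / 2 ^ n + eLpNorm (g - ⇑k) 2 (scalarMeasure Φ x)) atTop
      (𝓝 (0 + eLpNorm (g - ⇑k) 2 (scalarMeasure Φ x))) := by
    refine Tendsto.add ?_ tendsto_const_nhds
    have := ENNReal.tendsto_pow_atTop_nhds_zero_of_lt_one (r := 2⁻¹) (by norm_num)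
    simpa only [one_div, ENNReal.inv_pow] using this
  rw [zero_add] at h2
  refine le_of_tendsto_of_tendsto' h1 h2 fun n => ?_
  rw [enorm_sub_apply]
  exact ((isBddBorel_cont _).sub_comm_le (isBddBorel_cont _) hg _).trans (by gcongr; exact hf n)

theorem isRep_cont (f : C(X, ℂ)) (x : H) : IsRep Φ f x (Φ f x) := fun k =>
  (enorm_sub_apply Φ x k f).le

theorem eLpNorm_mul_le {g h : X → ℂ} {M : ℝ} (hM : ∀ z, ‖g z‖ ≤ M) (ν : Measure X) :
    eLpNorm (g * h) 2 ν ≤ ENNReal.ofReal M * eLpNorm h 2 ν := by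
  refine eLpNorm_le_mul_eLpNorm_of_ae_le_mul (ae_of_all _ fun z => ?_) 2
  rw [Pi.mul_apply, norm_mul]
  gcongr
  exact hM z

theorem IsRep.add {g : X → ℂ} (hg : IsBddBorel g) {x y v w : H} (hv : IsRep Φ g x v)
    (hw : IsRep Φ g y w) : IsRep Φ g (x + y) (v + w) := by
  refine isRep_of Φ hg 2 (by norm_num) fun ε hε hε' => ?_
  obtain ⟨k, hk⟩ := hg.approx
    (scalarMeasure Φ x + scalarMeasure Φ y + scalarMeasure Φ (x + y)) hε
  have h1 : eLpNorm (g - ⇑k) 2 (scalarMeasure Φ x) ≤ ε :=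
    (eLpNorm_mono_measure _ ((Measure.le_add_right le_rfl).trans (Measure.le_add_right le_rfl))).trans hk
  have h2 : eLpNorm (g - ⇑k) 2 (scalarMeasure Φ y) ≤ ε :=
    (eLpNorm_mono_measure _ ((Measure.le_add_left le_rfl).trans (Measure.le_add_right le_rfl))).trans hk
  have h3 : eLpNorm (g - ⇑k) 2 (scalarMeasure Φ (x + y)) ≤ ε :=
    (eLpNorm_mono_measure _ (Measure.le_add_left le_rfl)).trans hk
  refine ⟨k, h3.trans ?_, ?_⟩
  · rw [two_mul]; exact le_self_add
  · rw [map_add, add_sub_add_comm, two_mul]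
    exact (enorm_add_le _ _).trans (add_le_add ((hv k).trans h1) ((hw k).trans h2))

theorem IsRep.smul {g : X → ℂ} (hg : IsBddBorel g) {x v : H} (c : ℂ) (hv : IsRep Φ g x v) :
    IsRep Φ g (c • x) (c • v) := by
  refine isRep_of Φ hg (1 + ‖c‖ₑ) (by finiteness) fun ε hε hε' => ?_
  obtain ⟨k, hk⟩ := hg.approx (scalarMeasure Φ x + scalarMeasure Φ (c • x)) hε
  have h1 : eLpNorm (g - ⇑k) 2 (scalarMeasure Φ x) ≤ ε :=
    (eLpNorm_mono_measure _ (Measure.le_add_right le_rfl)).trans hk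
  have h3 : eLpNorm (g - ⇑k) 2 (scalarMeasure Φ (c • x)) ≤ ε :=
    (eLpNorm_mono_measure _ (Measure.le_add_left le_rfl)).trans hk
  refine ⟨k, h3.trans ?_, ?_⟩
  · rw [add_mul, one_mul]; exact le_self_add
  · rw [map_smul, ← smul_sub, enorm_smul, add_mul]
    refine le_trans ?_ le_add_self
    gcongr
    exact (hv k).trans h1

theorem IsRep.mul {g h : X → ℂ} (hg : IsBddBorel g) (hh : IsBddBorel h) {x v w : H}
    (hv : IsRep Φ g x v) (hw : IsRep Φ h v w) : IsRep Φ (h * g) x w := by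
  obtain ⟨M, hM⟩ := hg.2
  refine isRep_of Φ (hh.mul hg) (ENNReal.ofReal M + 1 + 1) (by finiteness) fun ε hε hε' => ?_
  obtain ⟨k, hk⟩ := hh.approx (scalarMeasure Φ v + scalarMeasure Φ x) hε
  have h1 : eLpNorm (h - ⇑k) 2 (scalarMeasure Φ v) ≤ ε :=
    (eLpNorm_mono_measure _ (Measure.le_add_right le_rfl)).trans hk
  have h2 : eLpNorm (h - ⇑k) 2 (scalarMeasure Φ x) ≤ ε :=
    (eLpNorm_mono_measure _ (Measure.le_add_left le_rfl)).trans hk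
  set D : ℝ≥0∞ := ENNReal.ofReal ‖k‖ + ‖Φ k‖ₑ + 1 with hD
  have hD0 : D ≠ ⊤ := by finiteness
  obtain ⟨f, hf⟩ := hg.approx (scalarMeasure Φ x) (ε := ε / D)
    (ENNReal.div_ne_zero.2 ⟨hε, hD0⟩)
  have hDε : ∀ a ≤ D, a * (ε / D) ≤ ε := fun a ha => by
    rw [← mul_div_assoc]
    refine ENNReal.div_le_of_le_mul ?_
    rw [mul_comm]
    gcongr
  refine ⟨k * f, ?_, ?_⟩
  · have e : h * g - ⇑(k * f) = g * (h - ⇑k) + ⇑k * (g - ⇑f) := by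
      ext z; simp; ring
    rw [e]
    refine le_trans ?_ (mul_le_mul' (le_self_add : _ ≤ ENNReal.ofReal M + 1 + 1) le_rfl)
    rw [add_mul, one_mul]
    refine (eLpNorm_add_le ((hg.mul (hh.sub (isBddBorel_cont k))).memLp _).1
      (((isBddBorel_cont k).mul (hg.sub (isBddBorel_cont f))).memLp _).1 (by norm_num)).trans ?_
    refine add_le_add ((eLpNorm_mul_le hM _).trans (by gcongr)) ?_
    refine (eLpNorm_mul_le k.norm_coe_le_norm _).trans ?_
    refine le_trans (by gcongr) (hDε (ENNReal.ofReal ‖k‖) ?_)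
    rw [hD, add_assoc]; exact le_self_add
  · have e : w - Φ (k * f) x = (w - Φ k v) + Φ k (v - Φ f x) := by
      rw [map_mul, mul_apply_eq_comp, map_sub]; abel
    have h4 : ‖Φ k (v - Φ f x)‖ₑ ≤ ε := by
      refine ((Φ k).le_opENorm _).trans ?_
      refine le_trans (mul_le_mul' le_rfl ((hv f).trans hf)) (hDε ‖Φ k‖ₑ ?_)
      rw [hD, add_assoc, add_left_comm]; exact le_self_add
    rw [e]
    refine (enorm_add_le _ _).trans ((add_le_add ((hw k).trans h1) h4).trans ?_)
    rw [add_mul, add_mul, one_mul, add_assoc]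
    exact le_add_self

theorem IsRep.add_fun {g h : X → ℂ} (hg : IsBddBorel g) (hh : IsBddBorel h) {x v w : H}
    (hv : IsRep Φ g x v) (hw : IsRep Φ h x w) : IsRep Φ (g + h) x (v + w) := by
  have hgh : IsBddBorel (g + h) := by
    have h0 : IsBddBorel (0 : X → ℂ) := isBddBorel_cont (0 : C(X, ℂ))
    simpa using hg.sub (h0.sub hh)
  refine isRep_of Φ hgh 2 (by norm_num) fun ε hε hε' => ?_
  obtain ⟨k, hk⟩ := hg.approx (scalarMeasure Φ x) hε
  obtain ⟨l, hl⟩ := hh.approx (scalarMeasure Φ x) hε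
  refine ⟨k + l, ?_, ?_⟩
  · have e : g + h - ⇑(k + l) = (g - ⇑k) + (h - ⇑l) := by
      rw [ContinuousMap.coe_add]; abel
    rw [e, two_mul]
    exact (eLpNorm_add_le ((hg.sub (isBddBorel_cont k)).memLp _).1
      ((hh.sub (isBddBorel_cont l)).memLp _).1 (by norm_num)).trans (add_le_add hk hl)
  · rw [map_add, add_apply, add_sub_add_comm, two_mul]
    exact (enorm_add_le _ _).trans (add_le_add ((hv k).trans hk) ((hw l).trans hl))

theorem IsRep.inner_eq {g : X → ℂ} (hg : IsBddBorel g) {x v : H} (hv : IsRep Φ g x v) :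
    ⟪x, v⟫_ℂ = ∫ z, g z ∂(scalarMeasure Φ x) := by
  have key : ∀ ε : ℝ≥0∞, ε ≠ 0 → ‖⟪x, v⟫_ℂ - ∫ z, g z ∂(scalarMeasure Φ x)‖ₑ
      ≤ (‖x‖ₑ + (scalarMeasure Φ x) Set.univ ^ (1 / (1 : ℝ≥0∞).toReal - 1 / (2 : ℝ≥0∞).toReal)) * ε := by
    intro ε hε
    obtain ⟨f, hf⟩ := hg.approx (scalarMeasure Φ x) hε
    have hgi := (hg.memLp (scalarMeasure Φ x)).integrable (by norm_num)
    have hfi := ((isBddBorel_cont f).memLp (scalarMeasure Φ x)).integrable (by norm_num)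
    have e : ⟪x, v⟫_ℂ - ∫ z, g z ∂(scalarMeasure Φ x)
        = ⟪x, v - Φ f x⟫_ℂ - ∫ z, (g - ⇑f) z ∂(scalarMeasure Φ x) := by
      simp only [Pi.sub_apply]
      rw [integral_sub hgi hfi, integral_cont, inner_sub_right]
      ring
    rw [e, add_mul]
    refine enorm_sub_le.trans (add_le_add ?_ ?_)
    · have : ‖⟪x, v - Φ f x⟫_ℂ‖ₑ ≤ ‖x‖ₑ * ‖v - Φ f x‖ₑ := by
        have := norm_inner_le_norm (𝕜 := ℂ) x (v - Φ f x)
        rw [← ofReal_norm, ← ofReal_norm, ← ofReal_norm, ← ENNReal.ofReal_mul (norm_nonneg _)]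
        exact ENNReal.ofReal_le_ofReal this
      refine this.trans ?_
      gcongr
      exact (hv f).trans hf
    · refine (enorm_integral_le_lintegral_enorm _).trans ?_
      rw [← eLpNorm_one_eq_lintegral_enorm]
      refine (eLpNorm_le_eLpNorm_mul_rpow_measure_univ (p := 1) (q := 2) (by norm_num)
        ((hg.sub (isBddBorel_cont f)).memLp _).1).trans ?_
      rw [mul_comm]
      gcongr
  set C := ‖x‖ₑ + (scalarMeasure Φ x) Set.univ ^ (1 / (1 : ℝ≥0∞).toReal - 1 / (2 : ℝ≥0∞).toReal)
    with hC
  have hC' : C ≠ ⊤ := by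
    refine ENNReal.add_ne_top.2 ⟨by finiteness, ENNReal.rpow_ne_top_of_nonneg (by norm_num) ?_⟩
    finiteness
  have h0 : ‖⟪x, v⟫_ℂ - ∫ z, g z ∂(scalarMeasure Φ x)‖ₑ ≤ 0 := by
    refine ENNReal.le_of_forall_pos_le_add fun δ hδ _ => ?_
    rw [zero_add]
    refine (key (δ / (C + 1)) (ENNReal.div_ne_zero.2 ⟨by simpa using hδ.ne', by finiteness⟩)).trans ?_
    rw [← mul_div_assoc]
    refine ENNReal.div_le_of_le_mul ?_
    rw [mul_comm]
    gcongr
    exact le_self_add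
  simpa [sub_eq_zero] using h0

/-- The operator `g(Φ)` for a bounded Borel function `g`. -/
def op {g : X → ℂ} (hg : IsBddBorel g) : H →L[ℂ] H :=
  LinearMap.mkContinuous
    { toFun := fun x => (exists_isRep Φ hg x).choose
      map_add' := fun x y => (exists_isRep Φ hg (x + y)).choose_spec.unique Φ hg
        (IsRep.add Φ hg (exists_isRep Φ hg x).choose_spec (exists_isRep Φ hg y).choose_spec)
      map_smul' := fun c x => (exists_isRep Φ hg (c • x)).choose_spec.unique Φ hg
        (IsRep.smul Φ hg c (exists_isRep Φ hg x).choose_spec) }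
    hg.2.choose
    (fun x => by
      have h := (exists_isRep Φ hg x).choose_spec 0
      set v := (exists_isRep Φ hg x).choose
      have h1 := eLpNorm_mul_le hg.2.choose_spec (h := ⇑(1 : C(X, ℂ))) (scalarMeasure Φ x)
      have e1 : g * ⇑(1 : C(X, ℂ)) = g := by ext z; simp
      have e0 : g - ⇑(0 : C(X, ℂ)) = g := by ext z; simp
      rw [← enorm_apply, e1, map_one, one_apply_eq_self] at h1
      rw [e0, map_zero, zero_apply, sub_zero] at h
      have h2 := h.trans h1
      change ‖v‖ ≤ _
      by_cases hx : x = 0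
      · subst hx
        simpa using h2
      · have hX : 0 ≤ hg.2.choose := by
          by_contra hneg
          rw [ENNReal.ofReal_of_nonpos (not_le.1 hneg).le, zero_mul] at h2
          have hμ : scalarMeasure Φ x ≠ 0 := fun h0 => by
            have := enorm_apply Φ x 1
            rw [h0] at this
            simp [hx] at this
          have : Nonempty X := by
            by_contra hne
            rw [not_nonempty_iff] at hne
            exact hμ (Measure.eq_zero_of_isEmpty _)
          exact hneg ((norm_nonneg _).trans (hg.2.choose_spec this.some))
        rw [← ofReal_norm, ← ofReal_norm, ← ENNReal.ofReal_mul hX] at h2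
        exact (ENNReal.ofReal_le_ofReal_iff (by positivity)).1 h2)

theorem op_isRep {g : X → ℂ} (hg : IsBddBorel g) (x : H) : IsRep Φ g x (op Φ hg x) :=
  (exists_isRep Φ hg x).choose_spec

theorem inner_op {g : X → ℂ} (hg : IsBddBorel g) (x : H) :
    ⟪x, op Φ hg x⟫_ℂ = ∫ z, g z ∂(scalarMeasure Φ x) :=
  (op_isRep Φ hg x).inner_eq Φ hg

theorem isBddBorel_indicator {S : Set X} (hS : MeasurableSet S) :
    IsBddBorel (S.indicator (1 : X → ℂ)) := by
  refine ⟨measurable_one.indicator hS, 1, fun z => ?_⟩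
  by_cases h : z ∈ S <;> simp [h]

theorem inner_op_indicator {S : Set X} (hS : MeasurableSet S) (x : H) :
    ⟪x, op Φ (isBddBorel_indicator hS) x⟫_ℂ = ((scalarMeasure Φ x).real S : ℂ) := by
  rw [inner_op, integral_indicator hS]
  simp

theorem isStarProjection_op {S : Set X} (hS : MeasurableSet S) :
    IsStarProjection (op Φ (isBddBorel_indicator hS)) := by
  constructor
  · ext x
    rw [mul_apply_eq_comp]
    have h := (op_isRep Φ (isBddBorel_indicator hS) x).mul Φ (isBddBorel_indicator hS)
      (isBddBorel_indicator hS) (op_isRep Φ (isBddBorel_indicator hS) _)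
    rw [← Set.inter_indicator_one, Set.inter_self] at h
    exact h.unique Φ (isBddBorel_indicator hS) (op_isRep Φ (isBddBorel_indicator hS) x)
  · rw [ContinuousLinearMap.isSelfAdjoint_iff_isSymmetric,
      LinearMap.isSymmetric_iff_inner_map_self_real]
    intro x
    rw [← inner_conj_symm]
    simp only [ContinuousLinearMap.coe_coe]
    rw [inner_op_indicator Φ hS]
    simp

theorem tendsto_measure_diff (ν : Measure X) [IsFiniteMeasure ν] (S : ℕ → Set X)
    (hS : ∀ i, MeasurableSet (S i)) :
    Tendsto (fun s : Finset ℕ => ν ((⋃ i, S i) \ ⋃ i ∈ s, S i)) atTop (𝓝 0) := by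
  have h := tendsto_measure_iInter_atTop (μ := ν)
    (s := fun s : Finset ℕ => (⋃ i, S i) \ ⋃ i ∈ s, S i)
    (fun s => ((MeasurableSet.iUnion hS).diff
      (Finset.measurableSet_biUnion s fun i _ => hS i)).nullMeasurableSet)
    (fun s t hst => Set.sdiff_subset_sdiff_right (Set.biUnion_subset_biUnion_left hst))
    ⟨∅, by finiteness⟩
  have e : (⋂ s : Finset ℕ, (⋃ i, S i) \ ⋃ i ∈ s, S i) = ∅ := by
    rw [Set.eq_empty_iff_forall_notMem]
    intro z hz
    rw [Set.mem_iInter] at hz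
    obtain ⟨i, hi⟩ := Set.mem_iUnion.1 (hz ∅).1
    exact (hz {i}).2 (by simpa using hi)
  rwa [e, measure_empty] at h

theorem hasSum_op (S : ℕ → Set X) (hS : ∀ i, MeasurableSet (S i))
    (hd : Pairwise (Function.onFun Disjoint S)) (x : H) :
    HasSum (fun i => op Φ (isBddBorel_indicator (hS i)) x)
      (op Φ (isBddBorel_indicator (MeasurableSet.iUnion hS)) x) := by
  have hm : ∀ s : Finset ℕ, MeasurableSet (⋃ i ∈ s, S i) := fun s =>
    Finset.measurableSet_biUnion s fun i _ => hS i
  have hrep : ∀ s : Finset ℕ, IsRep Φ ((⋃ i ∈ s, S i).indicator 1) x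
      (∑ i ∈ s, op Φ (isBddBorel_indicator (hS i)) x) := by
    intro s
    induction s using Finset.induction_on with
    | empty =>
      have := isRep_cont Φ (0 : C(X, ℂ)) x
      have e : (⋃ i ∈ (∅ : Finset ℕ), S i).indicator (1 : X → ℂ) = ⇑(0 : C(X, ℂ)) := by
        ext z; simp
      rw [e]
      simpa using this
    | insert a s ha ih =>
      have h := (op_isRep Φ (isBddBorel_indicator (hS a)) x).add_fun Φ
        (isBddBorel_indicator (hS a)) (isBddBorel_indicator (hm s)) ih
      rw [Finset.sum_insert ha, Finset.set_biUnion_insert, Set.indicator_union_of_disjoint]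
      · exact h
      · rw [Set.disjoint_iUnion₂_right]
        exact fun i hi => hd (fun h => ha (h ▸ hi))
  have hle : ∀ s : Finset ℕ, ‖op Φ (isBddBorel_indicator (MeasurableSet.iUnion hS)) x
      - ∑ i ∈ s, op Φ (isBddBorel_indicator (hS i)) x‖ₑ
      ≤ (scalarMeasure Φ x ((⋃ i, S i) \ ⋃ i ∈ s, S i)) ^ (1 / 2 : ℝ) := by
    intro s
    refine ((op_isRep Φ _ x).sub_le Φ (isBddBorel_indicator (MeasurableSet.iUnion hS))
      (isBddBorel_indicator (hm s)) (hrep s)).trans ?_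
    rw [← Set.indicator_sdiff (Set.iUnion₂_subset fun i _ => Set.subset_iUnion S i)]
    refine (eLpNorm_indicator_const ((MeasurableSet.iUnion hS).diff (hm s)) (c := (1 : ℂ))
      (by norm_num) (by norm_num)).le.trans ?_
    simp
  have h0 : Tendsto (fun s : Finset ℕ =>
      (scalarMeasure Φ x ((⋃ i, S i) \ ⋃ i ∈ s, S i)) ^ (1 / 2 : ℝ)) atTop (𝓝 0) := by
    have := (ENNReal.continuous_rpow_const (y := (1 / 2 : ℝ))).tendsto 0 |>.comp
      (tendsto_measure_diff (scalarMeasure Φ x) S hS)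
    rw [ENNReal.zero_rpow_of_pos (by norm_num)] at this
    exact this
  rw [HasSum, SummationFilter.unconditional_filter, tendsto_iff_edist_tendsto_0]
  refine tendsto_of_tendsto_of_tendsto_of_le_of_le tendsto_const_nhds h0 (fun _ => zero_le)
    fun s => ?_
  rw [edist_comm, edist_eq_enorm_sub]
  exact hle s

/-- The projection-valued measure of a star homomorphism `Φ` on continuous functions:
`E(S) = 1_S(Φ)`. -/
def toProjectionValuedMeasure : ProjectionValuedMeasure X H where
  toFun S := open Classical in if hS : MeasurableSet S then op Φ (isBddBorel_indicator hS) else 0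
  isStarProjection S hS := by
    rw [dif_pos hS]
    exact isStarProjection_op Φ hS
  univ := by
    rw [dif_pos MeasurableSet.univ]
    ext x
    have h := isRep_cont Φ (1 : C(X, ℂ)) x
    have e : (Set.univ.indicator (1 : X → ℂ)) = ⇑(1 : C(X, ℂ)) := by ext z; simp
    rw [← e] at h
    rw [(op_isRep Φ (isBddBorel_indicator MeasurableSet.univ) x).unique Φ
      (isBddBorel_indicator MeasurableSet.univ) h, map_one]
  inter S T hS hT := by
    rw [dif_pos hS, dif_pos hT, dif_pos (hS.inter hT)]
    ext x
    rw [mul_apply_eq_comp]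
    have h := (op_isRep Φ (isBddBorel_indicator hT) x).mul Φ (isBddBorel_indicator hT)
      (isBddBorel_indicator hS) (op_isRep Φ (isBddBorel_indicator hS) _)
    rw [← Set.inter_indicator_one] at h
    exact (op_isRep Φ (isBddBorel_indicator (hS.inter hT)) x).unique Φ
      (isBddBorel_indicator (hS.inter hT)) h
  hasSum_iUnion S hS hd x := by
    simp only [hS, MeasurableSet.iUnion hS, dif_pos]
    exact hasSum_op Φ S hS hd x
  not_measurable S hS := dif_neg hS

theorem measure_toProjectionValuedMeasure (x : H) :
    (toProjectionValuedMeasure Φ).measure x = scalarMeasure Φ x := by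
  ext S hS
  rw [ProjectionValuedMeasure.measure, Measure.ofMeasurable_apply _ hS]
  have e : toProjectionValuedMeasure Φ S = op Φ (isBddBorel_indicator hS) := dif_pos hS
  rw [e, inner_op_indicator Φ hS]
  simp

theorem inner_integral {g : X → ℂ} (hg : IsBddBorel g) (x : H) :
    ⟪x, (toProjectionValuedMeasure Φ).integral g x⟫_ℂ
      = ∫ z, g z ∂((toProjectionValuedMeasure Φ).measure x) := by
  have h : ∀ x, ⟪x, op Φ hg x⟫_ℂ = ∫ z, g z ∂((toProjectionValuedMeasure Φ).measure x) := by
    intro x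
    rw [measure_toProjectionValuedMeasure, inner_op]
  rw [ProjectionValuedMeasure.integral_eq _ h, h]

theorem integral_continuous (f : C(X, ℂ)) : (toProjectionValuedMeasure Φ).integral f = Φ f :=
  ProjectionValuedMeasure.integral_eq _ fun x => by
    rw [measure_toProjectionValuedMeasure, integral_cont]

end Construction

end BorelCalculus

section Normal

variable {H : Type*} [NormedAddCommGroup H] [InnerProductSpace ℂ H] [CompleteSpace H]

/-- The spectral measure `E_A` of a normal operator `A`, a projection-valued measure on the
Borel sets of the spectrum of `A`. -/
def spectralMeasure (A : H →L[ℂ] H) [hA : IsStarNormal A] :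
    ProjectionValuedMeasure (spectrum ℂ A) H :=
  BorelCalculus.toProjectionValuedMeasure (cfcHom (R := ℂ) hA)

/-- The Borel functional calculus of a normal operator: `g(A) = ∫ g dE_A`. -/
def borelCalculus (A : H →L[ℂ] H) [IsStarNormal A] (g : spectrum ℂ A → ℂ) : H →L[ℂ] H :=
  (spectralMeasure A).integral g

/-- The defining property of the spectral measure: `A = ∫ z dE_A(z)`. -/
theorem borelCalculus_id (A : H →L[ℂ] H) [hA : IsStarNormal A] :
    borelCalculus A (fun z => (z : ℂ)) = A :=
  (BorelCalculus.integral_continuous (cfcHom (R := ℂ) hA) ⟨_, continuous_subtype_val⟩).trans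
    (cfcHom_id hA)

/-- The same property, written with the scalar measures `S ↦ ⟪x, E_A(S) x⟫`. -/
theorem inner_eq_integral_spectralMeasure (A : H →L[ℂ] H) [hA : IsStarNormal A] (x : H) :
    ⟪x, A x⟫_ℂ = ∫ z, (z : ℂ) ∂((spectralMeasure A).measure x) := by
  have h := BorelCalculus.inner_integral (cfcHom (R := ℂ) hA)
    (BorelCalculus.isBddBorel_cont ⟨_, continuous_subtype_val⟩) x
  rw [BorelCalculus.integral_continuous] at h
  have e := cfcHom_id (R := ℂ) hA
  rw [ContinuousMap.restrict] at e
  exact (congrArg (fun T : H →L[ℂ] H => ⟪x, T x⟫_ℂ) e).symm.trans h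

/-- On bounded Borel functions, `g(A)` is the operator with `⟪x, g(A) x⟫ = ∫ g d⟪x, E_A x⟫`. -/
theorem inner_borelCalculus (A : H →L[ℂ] H) [hA : IsStarNormal A] {g : spectrum ℂ A → ℂ}
    (hg : Measurable g) {M : ℝ} (hM : ∀ z, ‖g z‖ ≤ M) (x : H) :
    ⟪x, borelCalculus A g x⟫_ℂ = ∫ z, g z ∂((spectralMeasure A).measure x) :=
  BorelCalculus.inner_integral (cfcHom (R := ℂ) hA) ⟨hg, M, hM⟩ x

/-- On continuous functions, the Borel functional calculus is the continuous one. -/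
theorem borelCalculus_eq_cfc (A : H →L[ℂ] H) [hA : IsStarNormal A] {g : ℂ → ℂ}
    (hg : ContinuousOn g (spectrum ℂ A)) : borelCalculus A (fun z => g z) = cfc g A := by
  rw [cfc_apply g A hA hg]
  exact BorelCalculus.integral_continuous (cfcHom (R := ℂ) hA) ⟨_, hg.domRestrict⟩

end Normal

section Layers

/-- The partial composite `p_k ∘ ⋯ ∘ p_1` of the first `k` layers (of all the layers, if
`k ≥ K`); `p_j` is the entry of `p` with index `j - 1`. -/
def partialComposite {K : ℕ} (p : Fin K → ℂ → ℂ) : ℕ → ℂ → ℂ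
  | 0 => id
  | k + 1 => if h : k < K then p ⟨k, h⟩ ∘ partialComposite p k else partialComposite p k

/-- The composite `f = p_K ∘ ⋯ ∘ p_1` of all the layers. -/
def composite {K : ℕ} (p : Fin K → ℂ → ℂ) : ℂ → ℂ := partialComposite p K

end Layers

end

/-! ### Strong convergence in the Borel calculus of a star homomorphism -/

namespace BorelCalculus

variable {X : Type*} [TopologicalSpace X] [CompactSpace X] [T2Space X]
  [TopologicalSpace.PseudoMetrizableSpace X] [MeasurableSpace X] [BorelSpace X]
  {H : Type*} [NormedAddCommGroup H] [InnerProductSpace ℂ H] [CompleteSpace H]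
  (Φ : C(X, ℂ) →⋆ₐ[ℂ] (H →L[ℂ] H))

/-! For a vector `x`, let `μ_x` be the finite measure `S ↦ ⟪x, E_A(S) x⟫`. The map `g ↦ g(A) x` is a
contraction from bounded Borel functions with the `L²(μ_x)` seminorm into `H`; in difference form
this is `IsRep.sub_le`. Hence `‖f^m(A) x - χ(A) x‖` is at most the `L²(μ_x)` norm of `f^m - χ`,
which tends to `0` by dominated convergence: the iterates are bounded by one constant, and constants
are integrable for a finite measure. Convergence is obtained one vector at a time because the
measure depends on `x`. This is `tendsto_eLpNorm_two_sub_zero` followed by `tendsto_op_apply`.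

The layers enter through their continuity on `U`. Since the orbits stay in `U` wherever a layer is
applied, every iterate is continuous on the spectrum, hence Borel
(`continuousOn_iterate_composite`).

If `χ` takes only the values `0` and `1`, it is the indicator of `χ ⁻¹' {1}`, so `χ(A)` is a value
of the spectral measure and thus an orthogonal projection. It commutes with `A` because the calculus
is multiplicative, and its spectrum follows from the algebra of idempotents. -/

/-- Bridge from `integral`, which is determined only by its quadratic form, to `op`, for which the
`L²` estimates of `IsRep` are available. -/
theorem integral_eq_op {g : X → ℂ} (hg : IsBddBorel g) :
    (toProjectionValuedMeasure Φ).integral g = op Φ hg :=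
  ProjectionValuedMeasure.integral_eq _ fun x => by
    rw [measure_toProjectionValuedMeasure, inner_op]

/-- Applied to `x`, the two products are both values at `x` of the same function `g * f`, and such a
value is unique. -/
theorem commute_op {g : X → ℂ} (hg : IsBddBorel g) (f : C(X, ℂ)) :
    Commute (op Φ hg) (Φ f) := by
  ext x
  rw [mul_apply_eq_comp, mul_apply_eq_comp]
  have h1 := (isRep_cont Φ f x).mul Φ (isBddBorel_cont f) hg (op_isRep Φ hg (Φ f x))
  have h2 := (op_isRep Φ hg x).mul Φ hg (isBddBorel_cont f) (isRep_cont Φ f (op Φ hg x))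
  rw [mul_comm] at h2
  exact h1.unique Φ (hg.mul (isBddBorel_cont f)) h2

/-- The dominated convergence theorem in `L²` of a finite measure, for uniformly bounded sequences
of functions. -/
theorem tendsto_eLpNorm_two_sub_zero {g : ℕ → X → ℂ} {h : X → ℂ} {M : ℝ}
    (hg : ∀ m, Measurable (g m)) (hh : Measurable h) (hM : ∀ m z, ‖g m z‖ ≤ M)
    (hM' : ∀ z, ‖h z‖ ≤ M) (hlim : ∀ z, Tendsto (fun m => g m z) atTop (𝓝 (h z)))
    (ν : Measure X) [IsFiniteMeasure ν] :
    Tendsto (fun m => eLpNorm (g m - h) 2 ν) atTop (𝓝 0) := by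
  have h0 : Tendsto (fun m => ∫⁻ z, ‖g m z - h z‖ₑ ^ (2 : ℝ) ∂ν) atTop (𝓝 0) := by
    -- The dominating function is the constant `(M + M) ^ 2`, from the bound `M` on both `g m` and
    -- `h`; its integral is finite because `ν` is.
    have key := tendsto_lintegral_of_dominated_convergence (μ := ν)
      (F := fun m z => ‖g m z - h z‖ₑ ^ (2 : ℝ)) (f := fun _ => 0)
      (fun _ => ENNReal.ofReal (M + M) ^ (2 : ℝ))
      (fun m => ((hg m).sub hh).enorm.pow_const 2) ?_ ?_ ?_
    · simpa using key
    · refine fun m => ae_of_all _ fun z => ?_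
      refine ENNReal.rpow_le_rpow ?_ (by norm_num)
      rw [← ofReal_norm]
      exact ENNReal.ofReal_le_ofReal ((norm_sub_le _ _).trans (add_le_add (hM m z) (hM' z)))
    · rw [lintegral_const]
      finiteness
    · refine ae_of_all _ fun z => ?_
      have h1 : Tendsto (fun m => ‖g m z - h z‖ₑ) atTop (𝓝 0) := by
        simpa using ((hlim z).sub_const (h z)).enorm
      have := (ENNReal.continuous_rpow_const (y := (2 : ℝ))).tendsto 0 |>.comp h1
      rwa [ENNReal.zero_rpow_of_pos (by norm_num)] at this
  -- Continuity of the square root at `0` passes from the integral of the squares to the `L²` norm.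
  have := (ENNReal.continuous_rpow_const (y := (1 / 2 : ℝ))).tendsto 0 |>.comp h0
  rw [ENNReal.zero_rpow_of_pos (by norm_num)] at this
  simpa [eLpNorm_eq_lintegral_rpow_enorm_toReal, Function.comp_def] using this

/-- By `IsRep.sub_le`, the distance of the two vectors is at most the distance of the functions in
`L²` of the scalar measure of `x`, where dominated convergence applies. -/
theorem tendsto_op_apply {g : ℕ → X → ℂ} {h : X → ℂ} {M : ℝ}
    (hg : ∀ m, IsBddBorel (g m)) (hh : IsBddBorel h) (hM : ∀ m z, ‖g m z‖ ≤ M)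
    (hlim : ∀ z, Tendsto (fun m => g m z) atTop (𝓝 (h z))) (x : H) :
    Tendsto (fun m => op Φ (hg m) x) atTop (𝓝 (op Φ hh x)) := by
  have h0 := tendsto_eLpNorm_two_sub_zero (fun m => (hg m).1) hh.1 hM
    (fun z => le_of_tendsto' (hlim z).norm fun m => hM m z) hlim (scalarMeasure Φ x)
  rw [tendsto_iff_edist_tendsto_0]
  refine tendsto_of_tendsto_of_tendsto_of_le_of_le tendsto_const_nhds h0 (fun _ => zero_le)
    fun m => ?_
  rw [edist_eq_enorm_sub]
  exact (op_isRep Φ (hg m) x).sub_le Φ (hg m) hh (op_isRep Φ hh x)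

end BorelCalculus

/-! ### Continuity of the iterates on the spectrum -/

/-- One pass through the layers, with `g` standing for the previous iterate. Only inputs of layers
must lie in `U`, so `hU` stops at index `K - 1`; the index `k` is a free natural number because the
partial composites are constant from `K` on. -/
theorem continuousOn_partialComposite_comp {K : ℕ} {p : Fin K → ℂ → ℂ} {U s : Set ℂ} {g : ℂ → ℂ}
    (hp : ∀ k, ContinuousOn (p k) U) (hg : ContinuousOn g s)
    (hU : ∀ z ∈ s, ∀ k : Fin K, partialComposite p k (g z) ∈ U) (k : ℕ) :
    ContinuousOn (fun z => partialComposite p k (g z)) s := by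
  induction k with
  | zero => exact hg
  | succ k ih =>
    by_cases h : k < K
    · simp only [partialComposite, dif_pos h]
      exact (hp ⟨k, h⟩).comp ih fun z hz => hU z hz ⟨k, h⟩
    · simpa only [partialComposite, dif_neg h] using ih

theorem continuousOn_iterate_composite {K : ℕ} {p : Fin K → ℂ → ℂ} {U s : Set ℂ}
    (hp : ∀ k, ContinuousOn (p k) U)
    (hU : ∀ z ∈ s, ∀ (m : ℕ) (k : Fin K), partialComposite p k ((composite p)^[m] z) ∈ U)
    (m : ℕ) : ContinuousOn ((composite p)^[m]) s := by
  induction m with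
  | zero => exact continuousOn_id
  | succ m ih =>
    -- The new factor goes on the outside, `f ∘ f^m`, since `hU` controls the layers at the points
    -- `f^m z`.
    rw [Function.iterate_succ']
    exact continuousOn_partialComposite_comp hp ih (fun z hz => hU z hz m) K

/-! ### Idempotents, spectral projections and commutation -/

/-- If `e` were a unit, cancelling in `e * e = e` would give `e = 1`; if `1 - e` were one,
cancelling in `(1 - e) * e = 0` would give `e = 0`. -/
theorem IsIdempotentElem.spectrum_eq {𝕜 R : Type*} [Field 𝕜] [Ring R] [Algebra 𝕜 R] {e : R}
    (he : IsIdempotentElem e) (h0 : e ≠ 0) (h1 : e ≠ 1) : spectrum 𝕜 e = {0, 1} := by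
  refine (he.spectrum_subset 𝕜).antisymm ?_
  rintro z (rfl | rfl)
  · rw [spectrum.zero_mem_iff]
    exact fun hu => h1 (hu.mul_left_cancel (by rw [he.eq, mul_one]))
  · rw [spectrum.mem_iff, map_one]
    exact fun hu => h0 (hu.mul_left_cancel (by rw [he.one_sub_mul_self, mul_zero]))

theorem borelCalculus_eq_spectralMeasure {H : Type*} [NormedAddCommGroup H]
    [InnerProductSpace ℂ H] [CompleteSpace H] (A : H →L[ℂ] H) [hA : IsStarNormal A]
    {χ : spectrum ℂ A → ℂ} (hχ : Measurable χ) (h01 : ∀ z, χ z = 0 ∨ χ z = 1) :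
    borelCalculus A χ = spectralMeasure A (χ ⁻¹' {1}) := by
  have hS : MeasurableSet (χ ⁻¹' {1}) := hχ (measurableSet_singleton 1)
  have e : χ = (χ ⁻¹' {1}).indicator 1 := by
    ext z
    rcases h01 z with h | h <;> simp [h]
  -- Measurability selects the branch of the definition where `E(S)` is the operator of the
  -- indicator of `S`, rather than the default `0`.
  have h1 : spectralMeasure A (χ ⁻¹' {1})
      = BorelCalculus.op (cfcHom (R := ℂ) hA) (BorelCalculus.isBddBorel_indicator hS) := dif_pos hS
  rw [h1, ← BorelCalculus.integral_eq_op, ← e]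
  rfl

/-- `A` is itself the image under `cfcHom` of a continuous function, the coordinate `z`, so
`commute_op` applies. -/
theorem commute_borelCalculus {H : Type*} [NormedAddCommGroup H]
    [InnerProductSpace ℂ H] [CompleteSpace H] (A : H →L[ℂ] H) [hA : IsStarNormal A]
    {g : spectrum ℂ A → ℂ} (hg : BorelCalculus.IsBddBorel g) : Commute (borelCalculus A g) A := by
  have h := BorelCalculus.commute_op (cfcHom (R := ℂ) hA) hg
    ((ContinuousMap.id ℂ).restrict (spectrum ℂ A))
  rw [cfcHom_id hA, ← BorelCalculus.integral_eq_op] at h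
  exact h


/-! ### The main theorem -/

theorem theoremA {H : Type*} [NormedAddCommGroup H] [InnerProductSpace ℂ H] [CompleteSpace H]
    (A : H →L[ℂ] H) [IsStarNormal A]
    (U : Set ℂ) (hU : IsOpen U) (hAU : spectrum ℂ A ⊆ U)
    (K : ℕ) (p : Fin K → ℂ → ℂ) (hp : ∀ k, DifferentiableOn ℂ (p k) U)
    -- all the values met in the successive composition of the layers stay in their domain `U`
    (hdom : ∀ z ∈ spectrum ℂ A, ∀ (m : ℕ) (k : Fin K),
      partialComposite p k ((composite p)^[m] z) ∈ U)
    (hbdd : ∃ M : ℝ, ∀ (m : ℕ), ∀ z ∈ spectrum ℂ A, ‖(composite p)^[m] z‖ ≤ M)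
    (χ : spectrum ℂ A → ℂ) (hχ : Measurable χ)
    (hlim : ∀ z : spectrum ℂ A,
      Tendsto (fun m : ℕ => (composite p)^[m] (z : ℂ)) atTop (𝓝 (χ z))) :
    (∀ x : H, Tendsto
      (fun m : ℕ => borelCalculus A (fun z => (composite p)^[m] (z : ℂ)) x) atTop
      (𝓝 (borelCalculus A χ x))) ∧
    ((∀ z, χ z = 0 ∨ χ z = 1) →
      IsStarProjection (borelCalculus A χ) ∧
      Commute (borelCalculus A χ) A ∧
      borelCalculus A χ = spectralMeasure A (χ ⁻¹' {1}) ∧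
      Set.range (borelCalculus A χ) = Set.range (spectralMeasure A (χ ⁻¹' {1})) ∧
      (borelCalculus A χ ≠ 0 → borelCalculus A χ ≠ 1 →
        spectrum ℂ (borelCalculus A χ) = {0, 1})) := by
  obtain ⟨M, hM⟩ := hbdd
  have hg : ∀ m : ℕ, BorelCalculus.IsBddBorel
      (fun z : spectrum ℂ A => (composite p)^[m] (z : ℂ)) := fun m =>
    ⟨(continuousOn_iterate_composite (fun k => (hp k).continuousOn) hdom m).domRestrict.measurable,
      M, fun z => hM m z z.2⟩
  -- The bound `M` on the iterates passes to their pointwise limit.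
  have hχb : BorelCalculus.IsBddBorel χ :=
    ⟨hχ, M, fun z => le_of_tendsto' (hlim z).norm fun m => hM m z z.2⟩
  refine ⟨fun x => ?_, fun h01 => ?_⟩
  · have h := BorelCalculus.tendsto_op_apply (cfcHom (R := ℂ) (a := A) inferInstance) hg hχb
      (fun m z => hM m z z.2) hlim x
    simp only [← BorelCalculus.integral_eq_op] at h
    exact h
  · have hE := borelCalculus_eq_spectralMeasure A hχ h01
    have hP : IsStarProjection (borelCalculus A χ) := by
      rw [hE]
      exact (spectralMeasure A).isStarProjection _ (hχ (measurableSet_singleton 1))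
    exact ⟨hP, commute_borelCalculus A hχb, hE, by rw [hE],
      hP.isIdempotentElem.spectrum_eq⟩
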